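/- Conventions. All groups in question are finitely generated torsion-free nilpotent groups of class $2$. For such a group $G$ let $G'$ be its commutator subgroup and $I(G')=\{x\in G : x^k\in G' \text{ for some integer } k>0\}$ the isolator of $G'$; then $G'$ and $G/I(G')$ are abelian. For $n,t\ge 1$ let $\mathcal N_2(n,t)$ be the class of all finitely generated torsion-free nilpotent groups $G$ of class $2$ with $\operatorname{rank} G'=t$ and $\operatorname{rank} G/I(G')=n$. For $R=\mathbb Z$ or $\mathbb Q$ let $B_n(R)$ be the module of alternating bilinear forms on $R^n$ with standard basis $a_1,\dots,a_n$; a form in $B_n(\mathbb Z)$ is identified with the form in $B_n(\mathbb Q)$ having the same matrix. For a $t$-tuple $\Phi=(\varphi_1,\dots,\varphi_t)\in B_n(\mathbb Z)^t$ let $G(\Phi)$ be the group of formal products $a_1^{k_1}\cdots a_n^{k_n}b_1^{l_1}\cdots b_t^{l_t}$ ($k_i,l_j\in\mathbb Z$) with the multiplication $$a_1^{k_1}\cdots a_n^{k_n}b_1^{l_1}\cdots b_t^{l_t}\cdot a_1^{p_1}\cdots a_n^{p_n}b_1^{q_1}\cdots b_t^{q_t}=a_1^{k_1+p_1}\cdots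 a_n^{k_n+p_n}\prod_{r=1}^t b_r^{\,l_r+q_r+\sum_{i>j}k_ip_j\varphi_r(a_i,a_j)}.$$ Let $P_{n,t}\subset B_n(\mathbb Z)^t$ be the set of linearly independent $t$-tuples. A generic group of $\mathcal N_2(n,t)$ is said to have a property $\mathcal A$ if the set of those $\Phi\in P_{n,t}$ for which $G(\Phi)$ does not have property $\mathcal A$ is contained in a proper Zariski-closed subset of the affine space $B_n(\mathbb Q)^t$. Theorem. Let $n,n_0,t,t_0$ be positive integers. (1) If $$t<\frac{n(n-1)}2-\frac{nn_0}{t_0}+\frac{n_0^2}{t_0}+t_0-\frac{n_0(n_0-1)}2,$$ then a generic group of $\mathcal N_2(n,t)$ does not admit a surjective homomorphism onto a group of $\mathcal N_2(n_0,t_0)$. (2) If $n\ge n_0$ and $$t\ge\frac{n(n-1)}2-\frac{n_0(n_0-1)}2+t_0,$$ then every group of $\mathcal N_2(n,t)$ admits a surjective homomorphism onto a group of $\mathcal N_2(n_0,t_0)$. -/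

import Mathlib

noncomputable section

namespace TwoStepNilpotent

open scoped IsMulCommutative

universe u

/-! ### Finitely generated torsion-free 2-step nilpotent groups and their ranks -/

/-- The isolator `I(G') = {x | x ^ k ∈ G' for some k > 0}` of the commutator subgroup `G'`. -/
def isolatorCommutator (G : Type*) [Group G] : Subgroup G where
  carrier := {x | ∃ k : ℕ, 0 < k ∧ x ^ k ∈ commutator G}
  one_mem' := ⟨1, one_pos, by simp⟩
  mul_mem' := by
    rintro x y ⟨k, hk, hx⟩ ⟨m, hm, hy⟩
    refine ⟨k * m, Nat.mul_pos hk hm, ?_⟩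
    have hx' : (Abelianization.of x) ^ k = 1 := by
      rw [← map_pow]; exact (QuotientGroup.eq_one_iff _).2 hx
    have hy' : (Abelianization.of y) ^ m = 1 := by
      rw [← map_pow]; exact (QuotientGroup.eq_one_iff _).2 hy
    refine (QuotientGroup.eq_one_iff _).1 ?_
    change Abelianization.of ((x * y) ^ (k * m)) = 1
    rw [map_pow, map_mul, mul_pow, pow_mul, hx', one_pow, mul_comm k m, pow_mul, hy', one_pow,
      one_mul]
  inv_mem' := by
    rintro x ⟨k, hk, hx⟩
    exact ⟨k, hk, by rw [inv_pow]; exact inv_mem hx⟩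

theorem commutator_le_isolatorCommutator (G : Type*) [Group G] :
    commutator G ≤ isolatorCommutator G :=
  fun x hx => ⟨1, one_pos, by simpa using hx⟩

instance isolatorCommutator_normal (G : Type*) [Group G] : (isolatorCommutator G).Normal :=
  Subgroup.Normal.of_commutator_le G (commutator_le_isolatorCommutator G)

instance quotient_isMulCommutative (G : Type*) [Group G] :
    IsMulCommutative (G ⧸ isolatorCommutator G) :=
  Subgroup.Normal.quotient_commutative_iff_commutator_le.2 (commutator_le_isolatorCommutator G)

/-- In a group of nilpotency class two the commutator subgroup is abelian. -/
theorem commutator_isMulCommutative {G : Type*} [Group G] (h : Group.nilpotencyClass G = 2) :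
    IsMulCommutative (commutator G) := by
  have hG : Group.IsNilpotent G := by
    by_contra hG
    rw [Group.nilpotencyClass_of_not_nilpotent hG] at h
    omega
  have h2 : (⊤ : Subgroup G).lowerCentralSeries 2 = ⊥ :=
    Subgroup.lowerCentralSeries_eq_bot_iff_nilpotencyClass_le.2 h.le
  have h3 : ⁅commutator G, (⊤ : Subgroup G)⁆ = ⊥ := h2
  rw [Subgroup.commutator_eq_bot_iff_le_centralizer] at h3
  refine IsMulCommutative.of_setLike_mul_comm fun a ha b _ => ?_
  exact ((Subgroup.mem_centralizer_iff.1 (h3 ha)) b (Subgroup.mem_top b)).symm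

/-- The rank of an abelian group, that is, its rank as a `ℤ`-module. -/
def abelianRank (A : Type*) [Group A] [IsMulCommutative A] : ℕ :=
  Module.finrank ℤ (Additive A)

/-- Membership in `𝒩₂(n, t)`: finitely generated torsion-free nilpotent groups `G` of class two
with `rank G' = t` and `rank G / I(G') = n`. -/
structure MemN₂ (n t : ℕ) (G : Type*) [Group G] : Prop where
  fg : Group.FG G
  class_eq_two : Group.nilpotencyClass G = 2
  torsionFree : ∀ g : G, g ≠ 1 → ¬ IsOfFinOrder g
  rank_commutator :
    haveI := commutator_isMulCommutative class_eq_two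
    abelianRank (commutator G) = t
  rank_quotient : abelianRank (G ⧸ isolatorCommutator G) = n

/-- `G` admits a surjective homomorphism onto a group of `𝒩₂(n₀, t₀)`. -/
def SurjectsOntoN₂ (n₀ t₀ : ℕ) (G : Type u) [Group G] : Prop :=
  ∃ (H : Type u) (_ : Group H), MemN₂ n₀ t₀ H ∧ ∃ f : G →* H, Function.Surjective f

/-! ### Tuples of alternating forms and the associated groups -/

/-- The module `B_n(R)` of alternating bilinear forms on `R ^ n`. -/
def AltForms (R : Type*) [CommRing R] (n : ℕ) :
    Submodule R (LinearMap.BilinForm R (Fin n → R)) where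
  carrier := {φ | φ.IsAlt}
  zero_mem' := LinearMap.BilinForm.isAlt_zero
  add_mem' := fun h₁ h₂ => h₁.add h₂
  smul_mem' := fun a _ h => h.smul a

/-- The value `φ (a_i, a_j)` of a form on the standard basis `a_1, …, a_n`. -/
def entry {R : Type*} [CommRing R] {n : ℕ} (φ : AltForms R n) (i j : Fin n) : R :=
  φ.1 (Pi.single i 1) (Pi.single j 1)

/-- The rational form with the same (integer) matrix in the standard basis: the inclusion of
`B_n(ℤ)` in `B_n(ℚ)`. -/
def toRat {n : ℕ} (φ : AltForms ℤ n) : AltForms ℚ n :=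
  ⟨Matrix.toBilin' (Matrix.of fun i j => ((entry φ i j : ℤ) : ℚ)), by
    intro x
    have hskew : ∀ i j, ((entry φ i j : ℤ) : ℚ) = -((entry φ j i : ℤ) : ℚ) := fun i j => by
      have h : entry φ i j = -entry φ j i := (φ.2.neg_eq _ _).symm
      rw [h]
      push_cast
      rfl
    rw [Matrix.toBilin'_apply]
    have h : ∑ i, ∑ j, x i * ((entry φ i j : ℤ) : ℚ) * x j =
        -∑ i, ∑ j, x i * ((entry φ i j : ℤ) : ℚ) * x j := by
      conv_lhs => rw [Finset.sum_comm]
      simp only [← Finset.sum_neg_distrib]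
      refine Finset.sum_congr rfl fun i _ => Finset.sum_congr rfl fun j _ => ?_
      rw [hskew j i]
      ring
    simp only [Matrix.of_apply]
    linarith⟩

/-- `G(Φ)`: the set of formal products `a_1^{k_1} ⋯ a_n^{k_n} b_1^{l_1} ⋯ b_t^{l_t}` with integer
exponents, for a `t`-tuple `Φ` of integer alternating forms. -/
@[ext]
structure TupleGroup {n t : ℕ} (Φ : Fin t → AltForms ℤ n) : Type where
  k : Fin n → ℤ
  l : Fin t → ℤ

namespace TupleGroup

variable {n t : ℕ} {Φ : Fin t → AltForms ℤ n}

/-- The contribution `∑_{i > j} k_i p_j φ (a_i, a_j)` of a form to the multiplication. -/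
def cocycle (φ : AltForms ℤ n) (k p : Fin n → ℤ) : ℤ :=
  ∑ i, ∑ j, if j < i then k i * p j * entry φ i j else 0

theorem cocycle_add_left (φ : AltForms ℤ n) (k k' p : Fin n → ℤ) :
    cocycle φ (k + k') p = cocycle φ k p + cocycle φ k' p := by
  simp only [cocycle, ← Finset.sum_add_distrib]
  refine Finset.sum_congr rfl fun i _ => Finset.sum_congr rfl fun j _ => ?_
  split_ifs <;> simp [add_mul]

theorem cocycle_add_right (φ : AltForms ℤ n) (k p p' : Fin n → ℤ) :
    cocycle φ k (p + p') = cocycle φ k p + cocycle φ k p' := by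
  simp only [cocycle, ← Finset.sum_add_distrib]
  refine Finset.sum_congr rfl fun i _ => Finset.sum_congr rfl fun j _ => ?_
  split_ifs <;> simp [add_mul, mul_add]

theorem cocycle_neg_left (φ : AltForms ℤ n) (k p : Fin n → ℤ) :
    cocycle φ (-k) p = -cocycle φ k p := by
  have h := cocycle_add_left φ k (-k) p
  have h0 : cocycle φ 0 p = 0 := by simp [cocycle]
  rw [add_neg_cancel, h0] at h
  linarith

instance : Mul (TupleGroup Φ) :=
  ⟨fun x y => ⟨x.k + y.k, fun r => x.l r + y.l r + cocycle (Φ r) x.k y.k⟩⟩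

instance : One (TupleGroup Φ) := ⟨⟨0, 0⟩⟩

instance : Inv (TupleGroup Φ) :=
  ⟨fun x => ⟨-x.k, fun r => -x.l r + cocycle (Φ r) x.k x.k⟩⟩

@[simp] theorem mul_k (x y : TupleGroup Φ) : (x * y).k = x.k + y.k := rfl
@[simp] theorem mul_l (x y : TupleGroup Φ) (r : Fin t) :
    (x * y).l r = x.l r + y.l r + cocycle (Φ r) x.k y.k := rfl
@[simp] theorem one_k : (1 : TupleGroup Φ).k = 0 := rfl
@[simp] theorem one_l (r : Fin t) : (1 : TupleGroup Φ).l r = 0 := rfl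
@[simp] theorem inv_k (x : TupleGroup Φ) : (x⁻¹).k = -x.k := rfl
@[simp] theorem inv_l (x : TupleGroup Φ) (r : Fin t) :
    (x⁻¹).l r = -x.l r + cocycle (Φ r) x.k x.k := rfl

instance : Group (TupleGroup Φ) :=
  Group.ofLeftAxioms
    (by
      intro x y z
      ext r
      · simp [add_assoc]
      · simp only [mul_l, mul_k, cocycle_add_left, cocycle_add_right]
        ring)
    (by
      intro x
      ext r
      · simp
      · simp [cocycle])
    (by
      intro x
      ext r
      · simp
      · simp [cocycle_neg_left])

end TupleGroup

/-! ### Generic properties -/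

/-- Zariski-closed subsets of the affine space `B_n(ℚ) ^ t`: the common zero sets of families of
rational polynomials in the matrix entries of the forms. -/
def IsZariskiClosed {n t : ℕ} (Z : Set (Fin t → AltForms ℚ n)) : Prop :=
  ∃ S : Set (MvPolynomial (Fin t × Fin n × Fin n) ℚ),
    Z = {Ψ | ∀ p ∈ S, MvPolynomial.eval (fun c => entry (Ψ c.1) c.2.1 c.2.2) p = 0}

/-- A property `A` of groups is true generically on `𝒩₂(n, t)`: the linearly independent `t`-tuples
`Φ` of integer alternating forms for which `G(Φ)` fails `A` all lie in one proper Zariski-closed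
subset of `B_n(ℚ) ^ t`. -/
def IsGeneric (n t : ℕ) (A : ∀ (G : Type) [Group G], Prop) : Prop :=
  ∃ Z : Set (Fin t → AltForms ℚ n), IsZariskiClosed Z ∧ Z ≠ Set.univ ∧
    ∀ Φ : Fin t → AltForms ℤ n, LinearIndependent ℤ Φ → ¬ A (TupleGroup Φ) →
      (fun r => toRat (Φ r)) ∈ Z

end TwoStepNilpotent

end

noncomputable section

namespace TwoStepNilpotent

open scoped IsMulCommutative commutatorElement

/-! ### Bilinearity of commutators in class two -/

section ClassTwo

variable {G : Type*} [Group G]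

/-! In a torsion-free group `G` of class two, commutators are bilinear in the coordinates of `G /
I(G') ≅ ℤ^n` (`hom_commutatorOf_eq_sum`), so a homomorphism `G' → ℤ` amounts to an alternating form
in `n` variables. Write `N = n(n-1)/2` and `N₀ = n₀(n₀-1)/2`.

Part (1) is a dimension count. A surjection of `G(Φ)` onto `H` in `𝒩₂(n₀, t₀)` pulls the `t₀`
coordinates of `H'` back to independent rational combinations of the `φ_r`, all induced from forms
in `n₀` variables along one linear map `ℚ^n → ℚ^n₀` (`exists_isChart`). Once that map is the
identity on `n₀` basis vectors and the combinations are in echelon form, `t₀` of the forms are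
polynomials in the remaining data, which have `(n-n₀)n₀ + (t-t₀)N + t₀(t-t₀) + t₀N₀` parameters. The
hypothesis says exactly that this is less than `tN` (`card_chartVar_lt`), so the image lies in a
hypersurface; there are finitely many normalisations.

Part (2) is a construction. Keep the first `n₀` coordinates of `G / I(G')` and kill in `G'` the `N -
N₀` commutators of generators that involve a discarded one. At least `t₀` independent directions of
`G'` survive. A maximal normal subgroup compatible with both choices gives a torsion-free quotient
with exactly the ranks prescribed (`exists_maximal_complement`, `surjectsOntoN₂_of_homs`). -/

theorem commutator_central (h : Group.nilpotencyClass G = 2) {x : G} (hx : x ∈ commutator G)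
    (y : G) : x * y = y * x := by
  have hG : Group.IsNilpotent G := by
    by_contra hG
    rw [Group.nilpotencyClass_of_not_nilpotent hG] at h
    omega
  have h2 : (⊤ : Subgroup G).lowerCentralSeries 2 = ⊥ :=
    Subgroup.lowerCentralSeries_eq_bot_iff_nilpotencyClass_le.2 h.le
  have h3 : ⁅commutator G, (⊤ : Subgroup G)⁆ = ⊥ := h2
  rw [Subgroup.commutator_eq_bot_iff_le_centralizer] at h3
  exact ((Subgroup.mem_centralizer_iff.1 (h3 hx)) y (Subgroup.mem_top y)).symm

theorem commutatorElement_mem (x y : G) : ⁅x, y⁆ ∈ commutator G :=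
  Subgroup.commutator_mem_commutator (Subgroup.mem_top x) (Subgroup.mem_top y)

/-- The commutator `[x, y]` as an element of the commutator subgroup. -/
def commutatorOf (x y : G) : commutator G := ⟨⁅x, y⁆, commutatorElement_mem x y⟩

theorem commutatorOf_self (x : G) : commutatorOf x x = 1 := by
  ext; simp [commutatorOf]

theorem commutatorOf_inv (x y : G) : (commutatorOf x y)⁻¹ = commutatorOf y x := by
  ext; simp [commutatorOf, commutatorElement_inv]

theorem closure_commutatorOf :
    Subgroup.closure (Set.range fun z : G × G => commutatorOf z.1 z.2) = ⊤ := by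
  apply Subgroup.map_injective (commutator G).subtype_injective
  rw [MonoidHom.map_closure, ← MonoidHom.range_eq_map, Subgroup.range_subtype,
    ← Set.range_comp]
  refine Eq.trans ?_ (commutator_eq_closure G).symm
  congr 1
  ext z
  simp [commutatorOf, commutatorSet]

theorem mul_commutatorElement (h : Group.nilpotencyClass G = 2) (x x' y : G) :
    ⁅x * x', y⁆ = ⁅x, y⁆ * ⁅x', y⁆ := by
  have h1 : ⁅x * x', y⁆ = x * ⁅x', y⁆ * x⁻¹ * ⁅x, y⁆ := by
    simp only [commutatorElement_def]; group
  rw [h1, ← commutator_central h (commutatorElement_mem x' y) x, mul_inv_cancel_right,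
    commutator_central h (commutatorElement_mem x' y)]

/-- The homomorphism `x ↦ [x, y]` of a group of class two into its commutator subgroup. -/
def commutatorLeft (h : Group.nilpotencyClass G = 2) (y : G) : G →* commutator G where
  toFun x := commutatorOf x y
  map_one' := by ext; simp [commutatorOf]
  map_mul' x x' := by ext; exact mul_commutatorElement h x x' y

/-- Since `x ↦ [x, y]` is a homomorphism, `[x, y]^k = [x^k, y]`, which is trivial as soon as `x^k`
lies in the central subgroup `G'`; torsion-freeness removes the exponent. -/
theorem commutatorElement_eq_one_of_mem_isolator (h : Group.nilpotencyClass G = 2)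
    (htf : ∀ g : G, g ≠ 1 → ¬ IsOfFinOrder g) {x : G} (hx : x ∈ isolatorCommutator G) (y : G) :
    ⁅x, y⁆ = 1 := by
  obtain ⟨k, hk, hxk⟩ := hx
  by_contra hne
  refine htf _ hne (isOfFinOrder_iff_pow_eq_one.2 ⟨k, hk, ?_⟩)
  have h1 := map_pow (commutatorLeft h y) x k
  have h2 : (commutatorLeft h y (x ^ k) : G) = ⁅x, y⁆ ^ k := by rw [h1]; rfl
  rw [← h2]
  exact commutatorElement_eq_one_iff_mul_comm.2 (commutator_central h hxk y)

/-- A homomorphism into an abelian group that factors through `ℤ ^ n` is determined by its values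
on preimages of the standard basis. -/
theorem hom_eq_sum {n : ℕ} {A : Type*} [AddCommGroup A] {q : G →* Multiplicative (Fin n → ℤ)}
    (hq : Function.Surjective q) (χ : G →* Multiplicative A) (hχ : q.ker ≤ χ.ker) {e : Fin n → G}
    (he : ∀ i, q (e i) = Multiplicative.ofAdd (Pi.single i 1)) (x : G) :
    (χ x).toAdd = ∑ i, (q x).toAdd i • (χ (e i)).toAdd := by
  let ψ : Multiplicative (Fin n → ℤ) →* Multiplicative A :=
    q.liftOfRightInverse _ (Function.rightInverse_surjInv hq) ⟨χ, hχ⟩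
  have hψ : ∀ y, ψ (q y) = χ y := fun y =>
    q.liftOfRightInverse_comp_apply _ (Function.rightInverse_surjInv hq) ⟨χ, hχ⟩ y
  have hl := LinearMap.pi_apply_eq_sum_univ (AddMonoidHom.toMultiplicative.symm ψ).toIntLinearMap (q x).toAdd
  have h1 : (AddMonoidHom.toMultiplicative.symm ψ).toIntLinearMap (q x).toAdd = (χ x).toAdd := by
    rw [← hψ]; rfl
  rw [← h1, hl]
  refine Finset.sum_congr rfl fun i _ => ?_
  rw [← hψ (e i), he]
  have h2 : (fun j => if i = j then 1 else 0 : Fin n → ℤ) = Pi.single i 1 := by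
    ext j
    simp [Pi.single_apply, eq_comm]
  rw [h2]
  rfl

/-- Commutators in a torsion-free group of class two are bilinear in the coordinates of the
quotient by the isolator. -/
theorem hom_commutatorOf_eq_sum (h : Group.nilpotencyClass G = 2)
    (htf : ∀ g : G, g ≠ 1 → ¬ IsOfFinOrder g) {n : ℕ} {A : Type*} [AddCommGroup A]
    {q : G →* Multiplicative (Fin n → ℤ)} (hq : Function.Surjective q)
    (hker : q.ker = isolatorCommutator G) {e : Fin n → G}
    (he : ∀ i, q (e i) = Multiplicative.ofAdd (Pi.single i 1))
    (χ : commutator G →* Multiplicative A) (x y : G) :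
    (χ (commutatorOf x y)).toAdd =
      ∑ i, ∑ j, ((q x).toAdd i * (q y).toAdd j) • (χ (commutatorOf (e i) (e j))).toAdd := by
  have hle : ∀ y, q.ker ≤ (χ.comp (commutatorLeft h y)).ker := by
    intro y x hx
    rw [hker] at hx
    have h1 : commutatorLeft h y x = 1 :=
      Subtype.ext (commutatorElement_eq_one_of_mem_isolator h htf hx y)
    simp [MonoidHom.mem_ker, h1]
  have key : ∀ x y, (χ (commutatorOf x y)).toAdd =
      ∑ i, (q x).toAdd i • (χ (commutatorOf (e i) y)).toAdd := fun x y =>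
    hom_eq_sum hq (χ.comp (commutatorLeft h y)) (hle y) he x
  have key' : ∀ x y, (χ (commutatorOf x y)).toAdd =
      ∑ i, (q y).toAdd i • (χ (commutatorOf x (e i))).toAdd := by
    intro x y
    rw [← commutatorOf_inv, map_inv, toAdd_inv, key, ← Finset.sum_neg_distrib]
    refine Finset.sum_congr rfl fun i _ => ?_
    rw [← commutatorOf_inv x, map_inv, toAdd_inv, smul_neg, neg_neg]
  rw [key]
  refine Finset.sum_congr rfl fun i _ => ?_
  rw [key', Finset.smul_sum]
  exact Finset.sum_congr rfl fun j _ => by rw [smul_smul]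

theorem span_commutatorOf (h : Group.nilpotencyClass G = 2)
    (htf : ∀ g : G, g ≠ 1 → ¬ IsOfFinOrder g) {n : ℕ}
    {q : G →* Multiplicative (Fin n → ℤ)} (hq : Function.Surjective q)
    (hker : q.ker = isolatorCommutator G) {e : Fin n → G}
    (he : ∀ i, q (e i) = Multiplicative.ofAdd (Pi.single i 1)) :
    haveI := commutator_isMulCommutative h
    Submodule.span ℤ (Set.range fun z : Fin n × Fin n =>
      Additive.ofMul (commutatorOf (e z.1) (e z.2))) = ⊤ := by
  have := commutator_isMulCommutative h
  set S := Submodule.span ℤ (Set.range fun z : Fin n × Fin n =>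
      Additive.ofMul (commutatorOf (e z.1) (e z.2)))
  have h1 : Subgroup.closure (Set.range fun z : G × G => commutatorOf z.1 z.2) ≤
      AddSubgroup.toSubgroup' S.toAddSubgroup := by
    rw [Subgroup.closure_le]
    rintro _ ⟨z, rfl⟩
    -- For `χ` the identity of `G'`, the bilinear expansion expresses the commutator itself through
    -- the `[e i, e j]`.
    have h2 := hom_commutatorOf_eq_sum (A := Additive (commutator G)) h htf hq hker he
      (MonoidHom.id _) z.1 z.2
    change Additive.ofMul (commutatorOf z.1 z.2) ∈ S
    change Additive.ofMul (commutatorOf z.1 z.2) = _ at h2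
    rw [h2]
    exact Submodule.sum_mem _ fun i _ => Submodule.sum_mem _ fun j _ =>
      Submodule.smul_mem _ _ (Submodule.subset_span ⟨(i, j), rfl⟩)
  rw [closure_commutatorOf] at h1
  rw [eq_top_iff]
  intro z _
  exact h1 (Subgroup.mem_top z.toMul)

end ClassTwo

/-! ### Integer coordinates on `G / I(G')` and on `G'` -/

section Coordinates

variable {G : Type*} [Group G] {n t : ℕ}

theorem isTorsionFree_additive {A : Type*} [CommGroup A]
    (h : ∀ (a : A) (k : ℕ), 0 < k → a ^ k = 1 → a = 1) : Module.IsTorsionFree ℤ (Additive A) := by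
  rw [Module.isTorsionFree_iff_smul_eq_zero]
  intro r m hr
  by_contra! hne
  refine hne.2 (h m.toMul r.natAbs (Int.natAbs_pos.2 hne.1) ?_)
  have h1 : m.toMul ^ r = 1 := hr
  rcases Int.natAbs_eq r with h2 | h2
  · rw [h2, zpow_natCast] at h1; exact h1
  · rw [h2, zpow_neg, zpow_natCast, inv_eq_one] at h1; exact h1

theorem MemN₂.exists_quotient_coordinates (hG : MemN₂ n t G) :
    ∃ q : G →* Multiplicative (Fin n → ℤ), Function.Surjective q ∧
      q.ker = isolatorCommutator G := by
  have := hG.fg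
  have : Module.Finite ℤ (Additive (G ⧸ isolatorCommutator G)) := by
    rw [Module.Finite.iff_addGroup_fg, ← GroupFG.iff_add_fg]
    exact QuotientGroup.fg _
  have : Module.IsTorsionFree ℤ (Additive (G ⧸ isolatorCommutator G)) := by
    apply isTorsionFree_additive
    intro a k hk hak
    obtain ⟨x, rfl⟩ := QuotientGroup.mk_surjective a
    rw [← QuotientGroup.mk_pow, QuotientGroup.eq_one_iff] at hak
    obtain ⟨m, hm, hx⟩ := hak
    rw [QuotientGroup.eq_one_iff]
    exact ⟨k * m, Nat.mul_pos hk hm, by rwa [pow_mul]⟩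
  let b := (Module.finBasisOfFinrankEq ℤ (Additive (G ⧸ isolatorCommutator G)) hG.rank_quotient)
  refine ⟨(AddMonoidHom.toMultiplicativeRight (b.equivFun.toLinearMap.toAddMonoidHom)).comp
    (QuotientGroup.mk' _), ?_, ?_⟩
  · intro y
    obtain ⟨x, hx⟩ := QuotientGroup.mk_surjective (b.equivFun.symm y.toAdd).toMul
    refine ⟨x, ?_⟩
    change Multiplicative.ofAdd (b.equivFun (Additive.ofMul (x : G ⧸ isolatorCommutator G))) = y
    rw [hx, ofMul_toMul, LinearEquiv.apply_symm_apply, ofAdd_toAdd]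
  · ext x
    rw [MonoidHom.mem_ker, ← QuotientGroup.eq_one_iff]
    change b.equivFun (Additive.ofMul (x : G ⧸ isolatorCommutator G)) = 0 ↔ _
    rw [LinearEquiv.map_eq_zero_iff]
    rfl

theorem exists_coordinate_lift {q : G →* Multiplicative (Fin n → ℤ)}
    (hq : Function.Surjective q) :
    ∃ e : Fin n → G, ∀ i, q (e i) = Multiplicative.ofAdd (Pi.single i 1) :=
  ⟨fun _ => Function.surjInv hq _, fun _ => Function.surjInv_eq hq _⟩

theorem MemN₂.finite_commutator (hG : MemN₂ n t G) :
    haveI := commutator_isMulCommutative hG.class_eq_two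
    Module.Finite ℤ (Additive (commutator G)) := by
  have := commutator_isMulCommutative hG.class_eq_two
  obtain ⟨q, hq, hker⟩ := hG.exists_quotient_coordinates
  obtain ⟨e, he⟩ := exists_coordinate_lift hq
  exact ⟨⟨(Set.finite_range _).toFinset, by
    rw [Set.Finite.coe_toFinset]
    exact span_commutatorOf hG.class_eq_two hG.torsionFree hq hker he⟩⟩

theorem MemN₂.isTorsionFree_commutator (hG : MemN₂ n t G) :
    haveI := commutator_isMulCommutative hG.class_eq_two
    Module.IsTorsionFree ℤ (Additive (commutator G)) := by
  have := commutator_isMulCommutative hG.class_eq_two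
  apply isTorsionFree_additive
  intro a k hk hak
  by_contra hne
  refine hG.torsionFree a.1 (fun h => hne (Subtype.ext h)) (isOfFinOrder_iff_pow_eq_one.2
    ⟨k, hk, congrArg Subtype.val hak⟩)

theorem MemN₂.exists_commutator_coordinates (hG : MemN₂ n t G) :
    ∃ p : commutator G →* Multiplicative (Fin t → ℤ), Function.Bijective p := by
  have := commutator_isMulCommutative hG.class_eq_two
  have := hG.finite_commutator
  have := hG.isTorsionFree_commutator
  let b := (Module.finBasisOfFinrankEq ℤ (Additive (commutator G)) hG.rank_commutator)
  exact ⟨AddMonoidHom.toMultiplicativeRight (b.equivFun.toLinearMap.toAddMonoidHom),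
    b.equivFun.bijective⟩

end Coordinates

universe u

/-! ### Quotients with prescribed isolator and commutator subgroup -/

section Quotients

variable {G : Type*} [Group G] {n t : ℕ}

theorem abelianRank_eq_of_bijective {A : Type*} [Group A] [IsMulCommutative A]
    (p : A →* Multiplicative (Fin t → ℤ)) (hp : Function.Bijective p) : abelianRank A = t := by
  let e : Additive A ≃ₗ[ℤ] (Fin t → ℤ) :=
    (MulEquiv.toAdditiveLeft (MulEquiv.ofBijective p hp)).toIntLinearEquiv
  exact e.finrank_eq.trans (by simp)

theorem abelianRank_quotient_isolator {q : G →* Multiplicative (Fin n → ℤ)}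
    (hq : Function.Surjective q) (hker : q.ker = isolatorCommutator G) :
    abelianRank (G ⧸ isolatorCommutator G) = n := by
  let e := (QuotientGroup.quotientMulEquivOfEq hker.symm).trans
    (QuotientGroup.quotientKerEquivOfSurjective q hq)
  exact abelianRank_eq_of_bijective e.toMonoidHom e.bijective

theorem commutator_le_ker {A : Type*} [CommGroup A] (q : G →* A) : commutator G ≤ q.ker :=
  Abelianization.commutator_subset_ker q

theorem eq_one_of_pow_eq_one {k : ℕ} (hk : 0 < k) {a : Multiplicative (Fin n → ℤ)}
    (h : a ^ k = 1) : a = 1 := by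
  have h1 : k • a.toAdd = 0 := h
  have h2 : a.toAdd = 0 := (smul_eq_zero.1 h1).resolve_left hk.ne'
  exact h2

/-- A maximal complement: a normal subgroup `M` of `ker q` meeting `G'` exactly in `ker p` and such
that every element of `ker q` outside `M` is involved in `M G'`. -/
theorem exists_maximal_complement (q : G →* Multiplicative (Fin n → ℤ))
    (p : commutator G →* Multiplicative (Fin t → ℤ))
    (hpq : ∀ x ∈ q.ker, ∀ y, p (commutatorOf x y) = 1) :
    ∃ M : Subgroup G, M.Normal ∧ M ≤ q.ker ∧ (∀ z : commutator G, (z : G) ∈ M ↔ p z = 1) ∧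
      ∀ x ∈ q.ker, x ∉ M → ∃ m ∈ M, ∃ j : ℤ, ∃ z : commutator G, (z : G) = m * x ^ j ∧ p z ≠ 1 := by
  let S : Set (Subgroup G) := {M | M ≤ q.ker ∧ ∀ z : commutator G, (z : G) ∈ M ↔ p z = 1}
  have h0 : p.ker.map (commutator G).subtype ∈ S := by
    refine ⟨?_, fun z => ?_⟩
    · rintro _ ⟨z, _, rfl⟩
      exact commutator_le_ker q z.2
    · rw [← MonoidHom.mem_ker]
      exact Subgroup.mem_map_iff_mem (commutator G).subtype_injective
  obtain ⟨M, _, hM⟩ := zorn_le_nonempty₀ S (by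
    intro c hc hchain y hy
    refine ⟨sSup c, ⟨sSup_le fun N hN => (hc hN).1, fun z => ?_⟩, fun N hN => le_sSup hN⟩
    rw [Subgroup.mem_sSup_of_directedOn ⟨y, hy⟩ hchain.directedOn]
    exact ⟨fun ⟨N, hN, hz⟩ => ((hc hN).2 z).1 hz, fun hz => ⟨y, hy, ((hc hy).2 z).2 hz⟩⟩) _ h0
  obtain ⟨hMq, hMp⟩ := hM.prop
  -- Normality need not be imposed in the Zorn argument: `[m, g]` lies in `ker p`, hence in `M`.
  have hnormal : M.Normal := by
    refine ⟨fun m hm g => ?_⟩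
    have h1 : ((commutatorOf m g : commutator G) : G) ∈ M := (hMp _).2 (hpq m (hMq hm) g)
    have h2 : g * m * g⁻¹ = ((commutatorOf m g : commutator G) : G)⁻¹ * m := by
      simp only [commutatorOf, commutatorElement_def]; group
    rw [h2]
    exact M.mul_mem (M.inv_mem h1) hm
  refine ⟨M, hnormal, hMq, hMp, fun x hx hxM => ?_⟩
  have hnot : M ⊔ Subgroup.zpowers x ∉ S := fun hS =>
    hxM (hM.le_of_ge hS le_sup_left (Subgroup.mem_sup_right (Subgroup.mem_zpowers x)))
  have hle : M ⊔ Subgroup.zpowers x ≤ q.ker :=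
    sup_le hMq (Subgroup.zpowers_le.2 hx)
  have h3 : ∃ z : commutator G, (z : G) ∈ M ⊔ Subgroup.zpowers x ∧ p z ≠ 1 := by
    by_contra! hcon
    exact hnot ⟨hle, fun z => ⟨hcon z, fun hz => Subgroup.mem_sup_left ((hMp z).2 hz)⟩⟩
  obtain ⟨z, hz, hpz⟩ := h3
  obtain ⟨m, hm, y, ⟨j, rfl⟩, hmy⟩ := Subgroup.mem_sup_of_normal_left.1 hz
  exact ⟨m, hm, j, z, hmy.symm, hpz⟩

end Quotients

/-- The target is `G / M` for a maximal complement `M`. Because `M ∩ G' = ker p`, its commutator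
subgroup is `G' / ker p ≅ ℤ^t`. Maximality makes every element of `ker q` a root of an element of
`G'` modulo `M`, so `ker q / M` is the isolator, and the same relation excludes torsion. -/
theorem surjectsOntoN₂_of_homs {G : Type u} [Group G] {n t : ℕ} (hfg : Group.FG G)
    (hcl : Group.nilpotencyClass G = 2) (ht : 0 < t)
    (q : G →* Multiplicative (Fin n → ℤ)) (hq : Function.Surjective q)
    (p : commutator G →* Multiplicative (Fin t → ℤ)) (hp : Function.Surjective p)
    (hpq : ∀ x ∈ q.ker, ∀ y, p (commutatorOf x y) = 1) : SurjectsOntoN₂ n t G := by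
  obtain ⟨M, hnormal, hMq, hMp, hext⟩ := exists_maximal_complement q p hpq
  have hmapc : (commutator G).map (QuotientGroup.mk' M) = commutator (G ⧸ M) := by
    rw [commutator_def, Subgroup.map_commutator, commutator_def,
      Subgroup.map_top_of_surjective _ (QuotientGroup.mk'_surjective M)]
  have hqlift : ∀ x, QuotientGroup.lift M q hMq (QuotientGroup.mk' M x) = q x := fun x => rfl
  have hiso : (QuotientGroup.lift M q hMq).ker = isolatorCommutator (G ⧸ M) := by
    ext y
    obtain ⟨x, rfl⟩ := QuotientGroup.mk'_surjective M y
    rw [MonoidHom.mem_ker, hqlift]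
    constructor
    · intro hx
      by_cases hxM : x ∈ M
      · have : QuotientGroup.mk' M x = 1 := (QuotientGroup.eq_one_iff x).2 hxM
        rw [this]
        exact one_mem _
      · obtain ⟨m, hm, j, z, hz, hpz⟩ := hext x hx hxM
        have hj : j ≠ 0 := by
          rintro rfl
          rw [zpow_zero, mul_one] at hz
          exact hpz ((hMp z).1 (hz ▸ hm))
        have hxj : QuotientGroup.mk' M x ^ j ∈ commutator (G ⧸ M) := by
          rw [← hmapc]
          refine ⟨z, z.2, ?_⟩
          rw [hz, map_mul, map_zpow]
          have : QuotientGroup.mk' M m = 1 := (QuotientGroup.eq_one_iff m).2 hm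
          rw [this, one_mul]
        refine ⟨j.natAbs, Int.natAbs_pos.2 hj, ?_⟩
        rcases Int.natAbs_eq j with h | h
        · rwa [h, zpow_natCast] at hxj
        · rwa [h, zpow_neg, zpow_natCast, inv_mem_iff] at hxj
    · rintro ⟨k, hk, hxk⟩
      have h1 := commutator_le_ker (QuotientGroup.lift M q hMq) hxk
      rw [MonoidHom.mem_ker, map_pow, hqlift] at h1
      exact eq_one_of_pow_eq_one hk h1
  let r : commutator G →* commutator (G ⧸ M) :=
    ((QuotientGroup.mk' M).comp (commutator G).subtype).codRestrict _ fun z => by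
      rw [← hmapc]; exact ⟨z, z.2, rfl⟩
  have hr : Function.Surjective r := by
    rintro ⟨y, hy⟩
    rw [← hmapc] at hy
    obtain ⟨z, hz, rfl⟩ := hy
    exact ⟨⟨z, hz⟩, rfl⟩
  have hrker : ∀ z, r z = 1 ↔ p z = 1 := by
    intro z
    rw [← hMp, ← QuotientGroup.eq_one_iff]
    exact Subtype.ext_iff
  let p' : commutator (G ⧸ M) →* Multiplicative (Fin t → ℤ) :=
    r.liftOfRightInverse _ (Function.rightInverse_surjInv hr) ⟨p, fun z hz => (hrker z).1 hz⟩
  have hp' : ∀ z, p' (r z) = p z := fun z =>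
    r.liftOfRightInverse_comp_apply _ (Function.rightInverse_surjInv hr) ⟨p, _⟩ z
  have hbij : Function.Bijective p' := by
    constructor
    · rw [injective_iff_map_eq_one]
      intro y hy
      obtain ⟨z, rfl⟩ := hr y
      rw [hp'] at hy
      exact (hrker z).2 hy
    · intro a
      obtain ⟨z, rfl⟩ := hp a
      exact ⟨r z, hp' z⟩
  have hGnil : Group.IsNilpotent G := by
    by_contra hG
    rw [Group.nilpotencyClass_of_not_nilpotent hG] at hcl
    omega
  have hHnil : Group.IsNilpotent (G ⧸ M) :=
    Group.nilpotent_of_surjective _ (QuotientGroup.mk'_surjective M)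
  have hclass : Group.nilpotencyClass (G ⧸ M) = 2 := by
    have hle := Group.nilpotencyClass_le_of_surjective _ (QuotientGroup.mk'_surjective M)
    rw [hcl] at hle
    refine le_antisymm hle ?_
    -- In class at most one the commutator subgroup would be trivial, yet it maps onto `ℤ^t` with `t
    -- > 0`.
    by_contra hlt
    have h1 : (⊤ : Subgroup (G ⧸ M)).lowerCentralSeries 1 = ⊥ :=
      Subgroup.lowerCentralSeries_eq_bot_iff_nilpotencyClass_le.2 (by omega)
    have h2 : commutator (G ⧸ M) = ⊥ := h1
    obtain ⟨z, hz⟩ := hbij.2 (Multiplicative.ofAdd fun _ => 1)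
    have h3 : z = 1 := Subtype.ext (Subgroup.mem_bot.1 (h2.le z.2))
    rw [h3, map_one] at hz
    have h4 : (0 : Fin t → ℤ) = fun _ => 1 := hz
    exact zero_ne_one (congrFun h4 ⟨0, ht⟩)
  refine ⟨G ⧸ M, inferInstance, ⟨QuotientGroup.fg M, hclass, ?_, ?_, ?_⟩, QuotientGroup.mk' M,
    QuotientGroup.mk'_surjective M⟩
  · intro y hy hfin
    obtain ⟨x, rfl⟩ := QuotientGroup.mk'_surjective M y
    obtain ⟨k, hk, hxk⟩ := isOfFinOrder_iff_pow_eq_one.1 hfin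
    have hxM : x ∉ M := fun h => hy ((QuotientGroup.eq_one_iff x).2 h)
    have hx : x ∈ q.ker := by
      have h1 := congrArg (QuotientGroup.lift M q hMq) hxk
      rw [map_pow, hqlift, map_one] at h1
      exact eq_one_of_pow_eq_one hk h1
    obtain ⟨m, hm, j, z, hz, hpz⟩ := hext x hx hxM
    -- Modulo `M` the element `z` equals `x^j`, so `x^k ∈ M` forces `z^k ∈ M`, that is `p(z)^k = 1`
    -- with `p(z) ≠ 1`.
    have hzk : ((z ^ k : commutator G) : G) ∈ M := by
      rw [← QuotientGroup.eq_one_iff]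
      change QuotientGroup.mk' M ((z : G) ^ k) = 1
      have : QuotientGroup.mk' M m = 1 := (QuotientGroup.eq_one_iff m).2 hm
      rw [hz, map_pow, map_mul, map_zpow, this, one_mul, ← zpow_natCast, ← zpow_mul, mul_comm,
        zpow_mul, zpow_natCast, hxk, one_zpow]
    rw [hMp, map_pow] at hzk
    exact hpz (eq_one_of_pow_eq_one hk hzk)
  · have := commutator_isMulCommutative hclass
    exact abelianRank_eq_of_bijective p' hbij
  · refine abelianRank_quotient_isolator (q := QuotientGroup.lift M q hMq) ?_ hiso
    intro a
    obtain ⟨x, rfl⟩ := hq a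
    exact ⟨QuotientGroup.mk' M x, rfl⟩

/-! ### Surjections for large `t` -/

/-- Modulo its torsion, `L / D` is free of rank `rank L - rank D`; keep `t` of its coordinates. -/
theorem exists_surjective_of_finrank_le {L : Type*} [AddCommGroup L] [Module.Finite ℤ L]
    (D : Submodule ℤ L) {t : ℕ} (h : t + Module.finrank ℤ D ≤ Module.finrank ℤ L) :
    ∃ p : L →ₗ[ℤ] (Fin t → ℤ), Function.Surjective p ∧ D ≤ LinearMap.ker p := by
  have h1 := D.finrank_quotient_add_finrank
  let T := Submodule.torsion ℤ (L ⧸ D)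
  have h2 := T.finrank_quotient_add_finrank
  have h3 : Module.finrank ℤ T = 0 :=
    Module.finrank_eq_zero_iff_isTorsion.2 (Submodule.torsion_isTorsion (R := ℤ))
  let b := Module.finBasis ℤ ((L ⧸ D) ⧸ T)
  have hle : t ≤ Module.finrank ℤ ((L ⧸ D) ⧸ T) := by omega
  refine ⟨(LinearMap.funLeft ℤ ℤ (Fin.castLE hle)) ∘ₗ b.equivFun.toLinearMap ∘ₗ T.mkQ ∘ₗ D.mkQ,
    ?_, ?_⟩
  · exact (LinearMap.funLeft_surjective_of_injective ℤ ℤ _ (Fin.castLE_injective hle)).comp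
      (b.equivFun.surjective.comp ((T.mkQ_surjective).comp D.mkQ_surjective))
  · intro x hx
    have : D.mkQ x = 0 := by simpa using hx
    simp [LinearMap.mem_ker, this]

theorem MemN₂.surjectsOntoN₂ {G : Type u} [Group G] {n n₀ t t₀ : ℕ} (hG : MemN₂ n t G)
    (hn : n₀ ≤ n) (ht₀ : 0 < t₀) (ht : t₀ + ∑ j ∈ Finset.Ico n₀ n, j ≤ t) :
    SurjectsOntoN₂ n₀ t₀ G := by
  have := commutator_isMulCommutative hG.class_eq_two
  have := hG.finite_commutator
  obtain ⟨q, hq, hker⟩ := hG.exists_quotient_coordinates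
  obtain ⟨e, he⟩ := exists_coordinate_lift hq
  -- The pairs `i < j` with `n₀ ≤ j < n`: one for each commutator of two generators, up to
  -- inversion, that involves a discarded one.
  let ι := Σ j : Finset.Ico n₀ n, Fin j.1
  let v : ι → Additive (commutator G) := fun z => Additive.ofMul
    (commutatorOf (e ⟨z.1.1, (Finset.mem_Ico.1 z.1.2).2⟩)
      (e ⟨z.2.1, z.2.2.trans (Finset.mem_Ico.1 z.1.2).2⟩))
  have hcard : Fintype.card ι = ∑ j ∈ Finset.Ico n₀ n, j := by
    rw [Fintype.card_sigma]
    simp only [Fintype.card_fin]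
    exact Finset.sum_coe_sort (Finset.Ico n₀ n) fun j => j
  have hD : Module.finrank ℤ (Submodule.span ℤ (Set.range v)) ≤ Fintype.card ι :=
    finrank_range_le_card v
  have hrank : Module.finrank ℤ (Additive (commutator G)) = t := hG.rank_commutator
  obtain ⟨p, hp, hpD⟩ := exists_surjective_of_finrank_le (t := t₀)
    (Submodule.span ℤ (Set.range v)) (by omega)
  let q₀ : G →* Multiplicative (Fin n₀ → ℤ) :=
    (AddMonoidHom.toMultiplicative
      (LinearMap.funLeft ℤ ℤ (Fin.castLE hn)).toAddMonoidHom).comp q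
  have hq₀ : Function.Surjective q₀ :=
    (LinearMap.funLeft_surjective_of_injective ℤ ℤ _ (Fin.castLE_injective hn)).comp hq
  let P : commutator G →* Multiplicative (Fin t₀ → ℤ) :=
    AddMonoidHom.toMultiplicativeRight p.toAddMonoidHom
  have hPv : ∀ i j : Fin n, n₀ ≤ i.1 → j < i → P (commutatorOf (e i) (e j)) = 1 := by
    intro i j hi hj
    exact hpD (Submodule.subset_span
      ⟨⟨⟨i.1, Finset.mem_Ico.2 ⟨hi, i.2⟩⟩, ⟨j.1, hj⟩⟩, rfl⟩)
  have hPe : ∀ i j : Fin n, n₀ ≤ i.1 → P (commutatorOf (e i) (e j)) = 1 := by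
    intro i j hi
    rcases lt_trichotomy j i with hj | rfl | hj
    · exact hPv i j hi hj
    · rw [commutatorOf_self, map_one]
    · rw [← commutatorOf_inv, map_inv, hPv j i (hi.trans hj.le) hj, inv_one]
  refine surjectsOntoN₂_of_homs hG.fg hG.class_eq_two ht₀ q₀ hq₀ P hp fun x hx y => ?_
  have hsum := hom_commutatorOf_eq_sum hG.class_eq_two hG.torsionFree hq hker he P x y
  refine Multiplicative.toAdd.injective (hsum.trans ?_)
  refine Finset.sum_eq_zero fun i _ => Finset.sum_eq_zero fun j _ => ?_
  by_cases hi : n₀ ≤ i.1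
  · rw [hPe i j hi, toAdd_one, smul_zero]
  · have hx0 : (q x).toAdd i = 0 := congrFun (show (q₀ x).toAdd = 0 from hx) ⟨i.1, by omega⟩
    rw [hx0, zero_mul, zero_smul]

/-! ### The dimension count for one chart -/

section DimensionCount

open MvPolynomial

/-- The image of a polynomial map from an affine space of smaller dimension lies in a
hypersurface. -/
theorem exists_polynomial_vanishing_on_image {σ τ : Type} [Fintype σ] [Fintype τ]
    (h : Fintype.card σ < Fintype.card τ) (F : τ → MvPolynomial σ ℚ) :
    ∃ p : MvPolynomial τ ℚ, p ≠ 0 ∧ ∀ x : σ → ℚ, eval (fun i => eval x (F i)) p = 0 := by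
  -- Algebraically independent polynomials cannot outnumber the variables, whose number is the
  -- transcendence degree.
  have hF : ¬ AlgebraicIndependent ℚ F := fun hF => by
    have h1 := hF.cardinalMk_le_trdeg
    rw [MvPolynomial.trdeg_of_isDomain, Cardinal.lift_uzero, Cardinal.mk_fintype,
      Cardinal.mk_fintype] at h1
    exact absurd (Nat.cast_le.1 h1) (not_le.2 h)
  rw [algebraicIndependent_iff] at hF
  push Not at hF
  obtain ⟨p, hp, hp0⟩ := hF
  refine ⟨p, hp0, fun x => ?_⟩
  have h1 := AlgHom.congr_fun (comp_aeval F (aeval (R := ℚ) x)) p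
  rw [AlgHom.comp_apply, hp, map_zero] at h1
  simpa [aeval_eq_eval] using h1.symm

/-- The positions `(j, i)` with `i < j` of an `n × n` matrix. -/
abbrev Pairs (n : ℕ) : Type := Σ j : Fin n, Fin j.1

/-- The smaller of the two indices of a pair. -/
def Pairs.lower {n : ℕ} (z : Pairs n) : Fin n := ⟨z.2.1, z.2.2.trans z.1.2⟩

theorem two_mul_card_pairs (n : ℕ) : (2 : ℚ) * Fintype.card (Pairs n) = n * (n - 1) := by
  have h1 : Fintype.card (Pairs n) = ∑ j ∈ Finset.range n, j := by
    rw [Fintype.card_sigma]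
    simp only [Fintype.card_fin]
    exact Fin.sum_univ_eq_sum_range (fun j => j) n
  have h2 := Finset.sum_range_id_mul_two n
  rw [← h1] at h2
  rcases n with _ | n
  · simp
  · rw [Nat.add_sub_cancel] at h2
    have h3 : ((Fintype.card (Pairs (n + 1)) * 2 : ℕ) : ℚ) = ((n + 1) * n : ℕ) := by rw [h2]
    push_cast at h3 ⊢
    linarith

variable {n n₀ t t₀ : ℕ}

/-- Parameters for the tuples `φ` such that `t₀` independent combinations of the `φ r`, in
echelon form with respect to `J`, are induced from alternating forms in `n₀` variables along a
linear map that is the identity on the coordinates `I`. -/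
abbrev ChartVar (n n₀ t t₀ : ℕ) (I : Fin n₀ ↪ Fin n) (J : Fin t₀ ↪ Fin t) : Type :=
  ({i : Fin n // i ∉ Set.range I} × Fin n₀) ⊕ ({r : Fin t // r ∉ Set.range J} × Pairs n) ⊕
    (Fin t₀ × {r : Fin t // r ∉ Set.range J}) ⊕ (Fin t₀ × Pairs n₀)

open Classical in
theorem card_chartVar_lt (I : Fin n₀ ↪ Fin n) (J : Fin t₀ ↪ Fin t) (ht₀ : 0 < t₀)
    (h : (t : ℚ) < (n : ℚ) * (n - 1) / 2 - (n : ℚ) * n₀ / t₀ + (n₀ : ℚ) ^ 2 / t₀ + t₀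
          - (n₀ : ℚ) * (n₀ - 1) / 2) :
    Fintype.card (ChartVar n n₀ t t₀ I J) < Fintype.card (Fin t × Pairs n) := by
  have hI : Fintype.card {i : Fin n // i ∉ Set.range I} = n - n₀ := by
    rw [Fintype.card_subtype_compl]
    simp [Fintype.card_subtype, Finset.card_image_of_injective _ I.injective]
  have hJ : Fintype.card {r : Fin t // r ∉ Set.range J} = t - t₀ := by
    rw [Fintype.card_subtype_compl]
    simp [Fintype.card_subtype, Finset.card_image_of_injective _ J.injective]
  have hn : n₀ ≤ n := by simpa using Fintype.card_le_of_embedding I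
  have ht : t₀ ≤ t := by simpa using Fintype.card_le_of_embedding J
  simp only [ChartVar, Fintype.card_sum, Fintype.card_prod, hI, hJ, Fintype.card_fin]
  obtain ⟨m, rfl⟩ := Nat.exists_eq_add_of_le hn
  obtain ⟨s, rfl⟩ := Nat.exists_eq_add_of_le ht
  rw [Nat.add_sub_cancel_left, Nat.add_sub_cancel_left]
  have h1 := two_mul_card_pairs (n₀ + m)
  have h2 := two_mul_card_pairs n₀
  generalize Fintype.card (Pairs (n₀ + m)) = N at *
  generalize Fintype.card (Pairs n₀) = N₀ at *
  rw [← h1, ← h2] at h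
  have ht' : (0 : ℚ) < t₀ := by exact_mod_cast ht₀
  have h3 : (t₀ : ℚ) * ((t₀ + s : ℕ) : ℚ) < t₀ * (2 * N / 2 - ((n₀ + m : ℕ) : ℚ) * n₀ / t₀ +
      (n₀ : ℚ) ^ 2 / t₀ + t₀ - 2 * N₀ / 2) := mul_lt_mul_of_pos_left h ht'
  have h4 : (t₀ : ℚ) * (2 * N / 2 - ((n₀ + m : ℕ) : ℚ) * n₀ / t₀ +
      (n₀ : ℚ) ^ 2 / t₀ + t₀ - 2 * N₀ / 2) = t₀ * N - m * n₀ + t₀ * t₀ - t₀ * N₀ := by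
    push_cast
    field_simp
    ring
  rw [h4] at h3
  have h5 : ((m * n₀ + (s * N + (t₀ * s + t₀ * N₀)) : ℕ) : ℚ) < (((t₀ + s) * N : ℕ) : ℚ) := by
    push_cast at h3 ⊢
    linarith
  exact_mod_cast h5

/-- The conditions describing the tuples in the chart given by `I` and `J`. -/
structure IsChart (I : Fin n₀ ↪ Fin n) (J : Fin t₀ ↪ Fin t) (φ : Fin t → Fin n → Fin n → ℚ)
    (X : Fin n → Fin n₀ → ℚ) (c : Fin t₀ → Fin t → ℚ) (ψ : Fin t₀ → Fin n₀ → Fin n₀ → ℚ) :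
    Prop where
  X_eq : ∀ a b, X (I a) b = if a = b then 1 else 0
  c_eq : ∀ s s', c s (J s') = if s = s' then 1 else 0
  skew : ∀ s a b, ψ s a b = -ψ s b a
  sum_eq : ∀ s i j, ∑ r, c s r * φ r i j = ∑ a, ∑ b, X i a * X j b * ψ s a b

open Classical in
theorem exists_polynomial_vanishing_on_chart (I : Fin n₀ ↪ Fin n) (J : Fin t₀ ↪ Fin t)
    (ht₀ : 0 < t₀)
    (h : (t : ℚ) < (n : ℚ) * (n - 1) / 2 - (n : ℚ) * n₀ / t₀ + (n₀ : ℚ) ^ 2 / t₀ + t₀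
          - (n₀ : ℚ) * (n₀ - 1) / 2) :
    ∃ p : MvPolynomial (Fin t × Pairs n) ℚ, p ≠ 0 ∧ ∀ φ X c ψ, IsChart I J φ X c ψ →
      eval (fun z : Fin t × Pairs n => φ z.1 z.2.1 z.2.lower) p = 0 := by
  let XP : Fin n → Fin n₀ → MvPolynomial (ChartVar n n₀ t t₀ I J) ℚ := fun i a =>
    if hi : i ∉ Set.range I then X (Sum.inl (⟨i, hi⟩, a)) else C (if I a = i then 1 else 0)
  let ψP : Fin t₀ → Fin n₀ → Fin n₀ → MvPolynomial (ChartVar n n₀ t t₀ I J) ℚ := fun s a b =>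
    if h : b < a then X (Sum.inr (Sum.inr (Sum.inr (s, ⟨a, ⟨b, h⟩⟩))))
    else if h : a < b then -X (Sum.inr (Sum.inr (Sum.inr (s, ⟨b, ⟨a, h⟩⟩)))) else 0
  -- For `r = J s` the echelon form allows solving `sum_eq` for `φ r`; the chosen element is this
  -- `s`. The other forms are free parameters.
  let F : Fin t × Pairs n → MvPolynomial (ChartVar n n₀ t t₀ I J) ℚ := fun z =>
    if hr : z.1 ∉ Set.range J then X (Sum.inr (Sum.inl (⟨z.1, hr⟩, z.2)))
    else ∑ a, ∑ b, XP z.2.1 a * XP z.2.lower b * ψP (not_not.1 hr).choose a b -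
      ∑ r : {r : Fin t // r ∉ Set.range J},
        X (Sum.inr (Sum.inr (Sum.inl ((not_not.1 hr).choose, r)))) *
          X (Sum.inr (Sum.inl (r, z.2)))
  obtain ⟨p, hp, hpF⟩ := exists_polynomial_vanishing_on_image (card_chartVar_lt I J ht₀ h) F
  refine ⟨p, hp, fun φ X c ψ hφ => ?_⟩
  let x : ChartVar n n₀ t t₀ I J → ℚ := Sum.elim (fun z => X z.1 z.2)
    (Sum.elim (fun z => φ z.1 z.2.1 z.2.lower)
      (Sum.elim (fun z => c z.1 z.2) (fun z => ψ z.1 z.2.1 z.2.lower)))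
  have hX : ∀ i a, eval x (XP i a) = X i a := by
    intro i a
    by_cases hi : i ∈ Set.range I
    · obtain ⟨b, rfl⟩ := hi
      have : eval x (XP (I b) a) = if I a = I b then 1 else 0 := by simp [XP]
      rw [this, hφ.X_eq]
      simp [eq_comm]
    · simp only [XP, dif_pos hi, eval_X]
      rfl
  have hψ : ∀ s a b, eval x (ψP s a b) = ψ s a b := by
    intro s a b
    rcases lt_trichotomy a b with hab | rfl | hab
    · simp only [ψP, dif_neg hab.asymm, dif_pos hab, map_neg, eval_X]
      rw [hφ.skew s a b]
      rfl
    · have h1 := hφ.skew s a a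
      simp only [ψP, lt_irrefl, dif_neg, not_false_iff, map_zero]
      linarith
    · simp only [ψP, dif_pos hab, eval_X]
      rfl
  have hF : ∀ z, eval x (F z) = φ z.1 z.2.1 z.2.lower := by
    intro z
    by_cases hr : z.1 ∉ Set.range J
    · simp only [F, dif_pos hr, eval_X]
      rfl
    · simp only [F, dif_neg hr, map_sub, map_sum, map_mul, hX, hψ, eval_X]
      have hs := (not_not.1 hr).choose_spec
      set s := (not_not.1 hr).choose
      rw [← hφ.sum_eq, sub_eq_iff_eq_add,
        ← Fintype.sum_subtype_add_sum_subtype (fun r => r ∈ Set.range J)]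
      congr 1
      have h1 : ∀ r : {r : Fin t // r ∈ Set.range J}, r ≠ ⟨J s, s, rfl⟩ →
          c s r * φ r z.2.1 z.2.lower = 0 := by
        rintro ⟨_, s', rfl⟩ hne
        rw [hφ.c_eq, if_neg, zero_mul]
        rintro rfl
        exact hne rfl
      rw [Finset.sum_eq_single (⟨J s, s, rfl⟩ : {r : Fin t // r ∈ Set.range J})
        (fun r _ => h1 r) (by simp)]
      simp only [hφ.c_eq, if_true, one_mul]
      rw [← hs]
  simpa only [hF] using hpF x

end DimensionCount

/-! ### Linear algebra over `ℚ` and matrices of forms -/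

section LinearAlgebra

/-- From a spanning family of vectors one can choose a basis; `D` holds its dual basis. -/
theorem exists_embedding_dual {ι : Type*} {d : ℕ} (v : ι → Fin d → ℚ)
    (hv : Submodule.span ℚ (Set.range v) = ⊤) :
    ∃ (I : Fin d ↪ ι) (D : Fin d → Fin d → ℚ),
      (∀ a b, ∑ s, D b s * v (I a) s = if a = b then 1 else 0) ∧
      ∀ x : Fin d → ℚ, x = ∑ a, (∑ s, D a s * x s) • v (I a) := by
  have hd : Module.finrank ℚ (Submodule.span ℚ (Set.range v)) = d := by
    rw [hv, finrank_top, Module.finrank_fin_fun]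
  have h1 := Submodule.exists_fun_fin_finrank_span_eq ℚ (Set.range v)
  rw [hd] at h1
  obtain ⟨f, hf, hspan, hli⟩ := h1
  choose I hI using hf
  let b := Module.Basis.mk hli (by rw [hspan, hv])
  have hb : ∀ a, b a = v (I a) := fun a => by rw [Module.Basis.mk_apply, hI]
  have hD : ∀ a (x : Fin d → ℚ), ∑ s, b.coord a (Pi.single s 1) * x s = b.coord a x := by
    intro a x
    conv_rhs => rw [LinearMap.pi_apply_eq_sum_univ (b.coord a) x]
    refine Finset.sum_congr rfl fun s _ => ?_
    have : (fun j => if s = j then 1 else 0 : Fin d → ℚ) = Pi.single s 1 := by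
      ext j; simp [Pi.single_apply, eq_comm]
    rw [this, smul_eq_mul, mul_comm]
  refine ⟨⟨I, fun a a' h => hli.injective ?_⟩, fun a s => b.coord a (Pi.single s 1), ?_, ?_⟩
  · rw [← hI, ← hI, h]
  · intro a a'
    rw [hD]
    change b.coord a' (v (I a)) = _
    rw [← hb, Module.Basis.coord_apply, Module.Basis.repr_self, Finsupp.single_apply]
  · intro x
    simp only [hD]
    change x = ∑ a, b.coord a x • v (I a)
    simp only [← hb]
    exact (b.sum_repr x).symm

theorem span_eq_top_of_dual {ι : Type*} {d : ℕ} (v : ι → Fin d → ℚ)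
    (h : ∀ D : Fin d → ℚ, (∀ i, ∑ s, D s * v i s = 0) → D = 0) :
    Submodule.span ℚ (Set.range v) = ⊤ := by
  by_contra hne
  obtain ⟨f, hf, hle⟩ := Submodule.exists_le_ker_of_lt_top _ (lt_top_iff_ne_top.2 hne)
  have hfs : ∀ x : Fin d → ℚ, f x = ∑ s, f (Pi.single s 1) * x s := by
    intro x
    rw [LinearMap.pi_apply_eq_sum_univ f x]
    refine Finset.sum_congr rfl fun s _ => ?_
    have : (fun j => if s = j then 1 else 0 : Fin d → ℚ) = Pi.single s 1 := by
      ext j; simp [Pi.single_apply, eq_comm]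
    rw [this, smul_eq_mul, mul_comm]
  have h0 := h (fun s => f (Pi.single s 1)) fun i => by
    rw [← hfs]; exact hle (Submodule.subset_span ⟨i, rfl⟩)
  refine hf (LinearMap.ext fun x => ?_)
  rw [hfs]
  exact Finset.sum_eq_zero fun s _ => by rw [congrFun h0 s]; simp

/-- A vector is a combination of finitely many others if it satisfies every integral linear
relation that they satisfy. -/
theorem exists_combination_of_int_relations {ι : Type*} [Fintype ι] {t : ℕ} (L : Fin t → ι → ℚ)
    (K : ι → ℚ)
    (h : ∀ y : ι → ℤ, (∀ r, ∑ z, (y z : ℚ) * L r z = 0) → ∑ z, (y z : ℚ) * K z = 0) :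
    ∃ c : Fin t → ℚ, ∀ z, K z = ∑ r, c r * L r z := by
  classical
  let φ : (ι → ℚ) → (ι → ℚ) →ₗ[ℚ] ℚ := fun v => Fintype.linearCombination ℚ v
  have hφ : ∀ v y, φ v y = ∑ z, y z * v z := fun v y => by
    simp [φ, Fintype.linearCombination_apply]
  have hmem : φ K ∈ Submodule.span ℚ (Set.range fun r => φ (L r)) := by
    apply mem_span_of_iInf_ker_le_ker
    intro y hy
    rw [Submodule.mem_iInf] at hy
    -- Only integral relations are covered by the hypothesis, so the denominators of `y` are
    -- cleared.
    obtain ⟨⟨m, hm⟩, hmy⟩ := IsLocalization.exist_integer_multiples_of_finite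
      (nonZeroDivisors ℤ) y
    choose y' hy' using hmy
    have hm0 : (m : ℚ) ≠ 0 := by exact_mod_cast nonZeroDivisors.ne_zero hm
    have hy'' : ∀ z, (y' z : ℚ) = m * y z := fun z => by simpa using hy' z
    have h1 := h y' fun r => by
      have h2 : φ (L r) y = 0 := hy r
      rw [hφ] at h2
      simp only [hy'', mul_assoc, ← Finset.mul_sum, h2, mul_zero]
    simp only [hy'', mul_assoc, ← Finset.mul_sum] at h1
    rw [LinearMap.mem_ker, hφ]
    exact (mul_eq_zero.1 h1).resolve_left hm0
  obtain ⟨c, hc⟩ := (Submodule.mem_span_range_iff_exists_fun ℚ).1 hmem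
  refine ⟨c, fun z => ?_⟩
  have h1 := LinearMap.congr_fun hc (Pi.single z 1)
  simp only [LinearMap.sum_apply, LinearMap.smul_apply, hφ] at h1
  simpa [Pi.single_apply] using h1.symm

theorem altForms_ext {R : Type*} [CommRing R] {n : ℕ} {φ ψ : AltForms R n}
    (h : ∀ i j, entry φ i j = entry ψ i j) : φ = ψ := by
  refine Subtype.ext (LinearMap.BilinForm.ext_basis (Pi.basisFun R (Fin n)) fun i j => ?_)
  simpa [entry] using h i j

theorem entry_sum_smul {R : Type*} [CommRing R] {n : ℕ} {ι : Type*} [Fintype ι] (γ : ι → R)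
    (φ : ι → AltForms R n) (i j : Fin n) :
    entry (∑ r, γ r • φ r) i j = ∑ r, γ r * entry (φ r) i j := by
  simp [entry, LinearMap.sum_apply]

theorem exists_altForm_of_skew {n : ℕ} (M : Fin n → Fin n → ℚ) (hM : ∀ i j, M i j = -M j i) :
    ∃ φ : AltForms ℚ n, ∀ i j, entry φ i j = M i j := by
  refine ⟨⟨Matrix.toBilin' (Matrix.of M), fun x => ?_⟩, fun i j => ?_⟩
  · rw [Matrix.toBilin'_apply]
    have h : ∑ i, ∑ j, x i * M i j * x j = -∑ i, ∑ j, x i * M i j * x j := by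
      conv_lhs => rw [Finset.sum_comm]
      simp only [← Finset.sum_neg_distrib]
      refine Finset.sum_congr rfl fun i _ => Finset.sum_congr rfl fun j _ => ?_
      rw [hM j i]
      ring
    simp only [Matrix.of_apply]
    linarith
  · simp [entry, Matrix.toBilin'_single]

theorem entry_toRat {n : ℕ} (φ : AltForms ℤ n) (i j : Fin n) :
    entry (toRat φ) i j = ((entry φ i j : ℤ) : ℚ) := by
  simp only [entry, toRat, Matrix.toBilin'_single, Matrix.of_apply]

theorem entry_swap {R : Type*} [CommRing R] {n : ℕ} (φ : AltForms R n) (i j : Fin n) :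
    entry φ i j = -entry φ j i := (φ.2.neg_eq _ _).symm

end LinearAlgebra

/-! ### Commutators and homomorphisms of `G(Φ)` -/

namespace TupleGroup

variable {n t : ℕ} {Φ : Fin t → AltForms ℤ n}

theorem cocycle_neg_right (φ : AltForms ℤ n) (k p : Fin n → ℤ) :
    cocycle φ k (-p) = -cocycle φ k p := by
  have h := cocycle_add_right φ k p (-p)
  have h0 : cocycle φ k 0 = 0 := by simp [cocycle]
  rw [add_neg_cancel, h0] at h
  linarith

theorem cocycle_single (φ : AltForms ℤ n) (i j : Fin n) :
    cocycle φ (Pi.single i 1) (Pi.single j 1) = if j < i then entry φ i j else 0 := by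
  rw [cocycle, Finset.sum_eq_single i, Finset.sum_eq_single j]
  · simp
  · intro b _ hb; simp [hb]
  · simp
  · intro b _ hb; simp [Pi.single_apply, hb]
  · simp

theorem commutator_l (x y : TupleGroup Φ) (r : Fin t) :
    (⁅x, y⁆).l r = cocycle (Φ r) x.k y.k - cocycle (Φ r) y.k x.k := by
  simp only [commutatorElement_def, mul_l, mul_k, inv_l, inv_k, cocycle_add_left,
    cocycle_neg_left, cocycle_neg_right]
  ring

/-- The generator `a_i` of `G(Φ)`. -/
def gen (Φ : Fin t → AltForms ℤ n) (i : Fin n) : TupleGroup Φ := ⟨Pi.single i 1, 0⟩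

theorem commutator_gen_l (i j : Fin n) (r : Fin t) :
    (⁅gen Φ i, gen Φ j⁆).l r = entry (Φ r) i j := by
  rw [commutator_l]
  simp only [gen, cocycle_single]
  rcases lt_trichotomy i j with h | rfl | h
  · rw [if_neg h.asymm, if_pos h, zero_sub, ← entry_swap]
  · have := entry_swap (Φ r) i i
    simp only [lt_irrefl, if_false]
    omega
  · rw [if_pos h, if_neg h.asymm, sub_zero]

/-- The exponents of `a_1, …, a_n`. -/
def kHom (Φ : Fin t → AltForms ℤ n) : TupleGroup Φ →* Multiplicative (Fin n → ℤ) where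
  toFun x := Multiplicative.ofAdd x.k
  map_one' := rfl
  map_mul' _ _ := rfl

/-- The central subgroup generated by `b_1, …, b_t`. -/
def ofL (Φ : Fin t → AltForms ℤ n) : Multiplicative (Fin t → ℤ) →* TupleGroup Φ where
  toFun l := ⟨0, l.toAdd⟩
  map_one' := rfl
  map_mul' x y := by
    ext r
    · simp
    · simp [cocycle]

theorem k_eq_zero_of_mem_commutator {x : TupleGroup Φ} (hx : x ∈ commutator (TupleGroup Φ)) :
    x.k = 0 :=
  commutator_le_ker (kHom Φ) hx

/-- The exponents of `b_1, …, b_t` on the commutator subgroup. -/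
def lHom (Φ : Fin t → AltForms ℤ n) :
    commutator (TupleGroup Φ) →* Multiplicative (Fin t → ℤ) where
  toFun x := Multiplicative.ofAdd x.1.l
  map_one' := rfl
  map_mul' x y := by
    refine Multiplicative.toAdd.injective (funext fun r => ?_)
    simp [k_eq_zero_of_mem_commutator x.2, cocycle]

theorem lHom_injective : Function.Injective (lHom Φ) := by
  intro x y h
  have h1 : x.1.l = y.1.l := h
  refine Subtype.ext (TupleGroup.ext ?_ h1)
  rw [k_eq_zero_of_mem_commutator x.2, k_eq_zero_of_mem_commutator y.2]

theorem commutator_tupleGroup_isMulCommutative (Φ : Fin t → AltForms ℤ n) :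
    IsMulCommutative (commutator (TupleGroup Φ)) :=
  IsMulCommutative.of_comm fun x y => lHom_injective (by rw [map_mul, map_mul, mul_comm])

theorem toAdd_lHom_commutatorOf_gen (i j : Fin n) (r : Fin t) :
    (lHom Φ (commutatorOf (gen Φ i) (gen Φ j))).toAdd r = entry (Φ r) i j :=
  commutator_gen_l i j r

/-- A homomorphism from `G'` to `ℤ` is, on the commutators of the generators, a rational
combination of the forms. -/
theorem exists_combination_of_hom (κ : commutator (TupleGroup Φ) →* Multiplicative ℤ) :
    ∃ c : Fin t → ℚ, ∀ i j, ((κ (commutatorOf (gen Φ i) (gen Φ j))).toAdd : ℚ) =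
      ∑ r, c r * ((entry (Φ r) i j : ℤ) : ℚ) := by
  have := commutator_tupleGroup_isMulCommutative Φ
  obtain ⟨c, hc⟩ := exists_combination_of_int_relations (ι := Fin n × Fin n)
    (fun r z => ((entry (Φ r) z.1 z.2 : ℤ) : ℚ))
    (fun z => ((κ (commutatorOf (gen Φ z.1) (gen Φ z.2))).toAdd : ℚ)) (by
      intro y hy
      -- An integral relation among the columns of form values is a product of commutators with
      -- trivial `b`-exponents, hence the identity, so `κ` respects the relation.
      let w : commutator (TupleGroup Φ) := ∏ z, commutatorOf (gen Φ z.1) (gen Φ z.2) ^ y z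
      have hw : w = 1 := by
        refine lHom_injective (Multiplicative.toAdd.injective (funext fun r => ?_))
        have h1 := hy r
        simp only [w, map_prod, map_zpow, toAdd_prod, toAdd_zpow, Finset.sum_apply, Pi.smul_apply,
          toAdd_lHom_commutatorOf_gen, smul_eq_mul, map_one, toAdd_one, Pi.zero_apply]
        exact_mod_cast h1
      have h2 : (κ w).toAdd = 0 := by rw [hw, map_one, toAdd_one]
      simp only [w, map_prod, map_zpow, toAdd_prod, toAdd_zpow, smul_eq_mul] at h2
      exact_mod_cast h2)
  exact ⟨c, fun i j => hc (i, j)⟩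

/-- Each coordinate of `χ` kills `[a_i, a_j] = ∏ b_r ^ φ_r(a_i, a_j)`, so its values on the `b_r`
are the coefficients of a linear relation among the `φ_r`; independence makes them vanish. -/
theorem hom_ofL_eq_one (hΦ : LinearIndependent ℤ Φ) {m : ℕ}
    (χ : TupleGroup Φ →* Multiplicative (Fin m → ℤ)) (l : Multiplicative (Fin t → ℤ)) :
    χ (ofL Φ l) = 1 := by
  refine Multiplicative.toAdd.injective (funext fun s => ?_)
  have hsum : ∀ l : Fin t → ℤ, (χ (ofL Φ (Multiplicative.ofAdd l))).toAdd s =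
      ∑ r, l r * (χ (ofL Φ (Multiplicative.ofAdd (Pi.single r 1)))).toAdd s := by
    intro l
    have h1 := hom_eq_sum (q := MonoidHom.id (Multiplicative (Fin t → ℤ)))
      (fun x => ⟨x, rfl⟩) (χ.comp (ofL Φ)) (fun x hx => by
        have : x = 1 := hx
        rw [this]; exact one_mem _)
      (e := fun r => Multiplicative.ofAdd (Pi.single r 1)) (fun _ => rfl)
      (Multiplicative.ofAdd l)
    have h2 := congrFun h1 s
    simpa [Finset.sum_apply] using h2
  have hrel : ∀ γ : Fin t → ℤ, (∀ i j, ∑ r, γ r * entry (Φ r) i j = 0) → ∀ r, γ r = 0 := by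
    intro γ hγ
    refine Fintype.linearIndependent_iffₛ.1 hΦ γ 0 (altForms_ext fun i j => ?_)
    rw [entry_sum_smul, entry_sum_smul, hγ]
    simp
  have hzero := hrel (fun r => (χ (ofL Φ (Multiplicative.ofAdd (Pi.single r 1)))).toAdd s) <| by
    intro i j
    have h1 : ofL Φ (Multiplicative.ofAdd fun r => entry (Φ r) i j) = ⁅gen Φ i, gen Φ j⁆ := by
      refine TupleGroup.ext ?_ (funext fun r => ?_)
      · exact (k_eq_zero_of_mem_commutator (commutatorElement_mem _ _)).symm
      · rw [commutator_gen_l]; rfl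
    have h2 := hsum fun r => entry (Φ r) i j
    have h3 : χ ⁅gen Φ i, gen Φ j⁆ = 1 :=
      MonoidHom.mem_ker.1 (commutator_le_ker χ (commutatorElement_mem _ _))
    rw [h1, h3] at h2
    exact (Finset.sum_congr rfl fun r _ => mul_comm _ _).trans h2.symm
  have h4 := hsum l.toAdd
  simp only [hzero, mul_zero, Finset.sum_const_zero] at h4
  exact h4

theorem hom_eq_sum_gen (hΦ : LinearIndependent ℤ Φ) {m : ℕ}
    (χ : TupleGroup Φ →* Multiplicative (Fin m → ℤ)) (x : TupleGroup Φ) :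
    (χ x).toAdd = ∑ i, x.k i • (χ (gen Φ i)).toAdd := by
  refine hom_eq_sum (q := kHom Φ) (fun k => ⟨⟨k.toAdd, 0⟩, rfl⟩) χ (fun x hx => ?_)
    (e := gen Φ) (fun _ => rfl) x
  have hx0 : x.k = 0 := hx
  have h1 : x = ofL Φ (Multiplicative.ofAdd x.l) := TupleGroup.ext hx0 rfl
  rw [h1]
  exact hom_ofL_eq_one hΦ χ _

end TupleGroup

/-! ### Every surjection gives a chart; the generic statement -/

section Charts

variable {n n₀ t t₀ : ℕ}

theorem bilin_sum_sum {ι : Type*} {m d : ℕ} (B : LinearMap.BilinForm ℚ (Fin d → ℚ))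
    (v : ι → Fin d → ℚ) (X : ι → Fin m → ℚ) (w : Fin m → Fin d → ℚ)
    (h : ∀ i, v i = ∑ a, X i a • w a) (i j : ι) :
    B (v i) (v j) = ∑ a, ∑ b, X i a * X j b * B (w a) (w b) := by
  rw [h i, h j]
  simp only [map_sum, map_smul, LinearMap.sum_apply, LinearMap.smul_apply, smul_eq_mul,
    Finset.mul_sum]
  rw [Finset.sum_comm]
  exact Finset.sum_congr rfl fun a _ => Finset.sum_congr rfl fun b _ => by ring

/-- If `G(Φ)` maps onto a group of `𝒩₂(n₀, t₀)`, then `Φ` lies in one of finitely many charts. -/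
theorem exists_isChart {Φ : Fin t → AltForms ℤ n} (hΦ : LinearIndependent ℤ Φ) {H : Type*}
    [Group H] (hH : MemN₂ n₀ t₀ H) (f : TupleGroup Φ →* H) (hf : Function.Surjective f) :
    ∃ (I : Fin n₀ ↪ Fin n) (J : Fin t₀ ↪ Fin t) (X : Fin n → Fin n₀ → ℚ) (c : Fin t₀ → Fin t → ℚ)
      (ψ : Fin t₀ → Fin n₀ → Fin n₀ → ℚ),
      IsChart I J (fun r i j => ((entry (Φ r) i j : ℤ) : ℚ)) X c ψ := by
  obtain ⟨q, hq, hker⟩ := hH.exists_quotient_coordinates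
  obtain ⟨p, hp⟩ := hH.exists_commutator_coordinates
  obtain ⟨e, he⟩ := exists_coordinate_lift hq
  let χ := q.comp f
  let u : Fin n → Fin n₀ → ℤ := fun i => (χ (TupleGroup.gen Φ i)).toAdd
  let v : Fin n → Fin n₀ → ℚ := fun i s => u i s
  -- Surjectivity of `χ` makes each standard basis vector an integral combination of the `u i`, so a
  -- functional killing all `v i` is zero.
  have hv : Submodule.span ℚ (Set.range v) = ⊤ := by
    refine span_eq_top_of_dual v fun D hD => funext fun s₀ => ?_
    obtain ⟨y, hy⟩ := hq (Multiplicative.ofAdd (Pi.single s₀ 1))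
    obtain ⟨x, rfl⟩ := hf y
    have h1 : (Pi.single s₀ 1 : Fin n₀ → ℤ) = ∑ i, x.k i • u i :=
      (congrArg Multiplicative.toAdd hy).symm.trans (TupleGroup.hom_eq_sum_gen hΦ χ x)
    have h2 : ∀ s, ((Pi.single s₀ 1 : Fin n₀ → ℤ) s : ℚ) = ∑ i, (x.k i : ℚ) * v i s := by
      intro s
      rw [h1, Finset.sum_apply]
      simp [v]
    have h3 : ∑ s, D s * ((Pi.single s₀ 1 : Fin n₀ → ℤ) s : ℚ) = D s₀ := by
      rw [Finset.sum_eq_single s₀]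
      · simp
      · intro s _ hs; simp [Pi.single_eq_of_ne hs]
      · simp
    rw [← h3]
    simp only [h2, Finset.mul_sum]
    rw [Finset.sum_comm]
    refine Finset.sum_eq_zero fun i _ => ?_
    rw [← mul_zero (x.k i : ℚ), ← hD i, Finset.mul_sum]
    exact Finset.sum_congr rfl fun s _ => by ring
  obtain ⟨I, D, hD, hexp⟩ := exists_embedding_dual v hv
  let κ : Fin t₀ → commutator H →* Multiplicative ℤ := fun s =>
    (AddMonoidHom.toMultiplicative (Pi.evalAddMonoidHom (fun _ : Fin t₀ => ℤ) s)).comp p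
  let f' : commutator (TupleGroup Φ) →* commutator H :=
    (f.comp (commutator (TupleGroup Φ)).subtype).codRestrict _ fun z => by
      have : f z ∈ (commutator (TupleGroup Φ)).map f := ⟨z, z.2, rfl⟩
      exact Subgroup.commutator_mono le_top le_top ((Subgroup.map_commutator _ _ f).le this)
  have hf' : ∀ x y, f' (commutatorOf x y) = commutatorOf (f x) (f y) := fun x y =>
    Subtype.ext (map_commutatorElement f x y)
  choose c₀ hc₀ using fun s => TupleGroup.exists_combination_of_hom ((κ s).comp f')
  let B : Fin t₀ → LinearMap.BilinForm ℚ (Fin n₀ → ℚ) := fun s =>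
    Matrix.toBilin' (Matrix.of fun a b => ((κ s (commutatorOf (e a) (e b))).toAdd : ℚ))
  have hBe : ∀ s a b, B s (Pi.single a 1) (Pi.single b 1) =
      ((κ s (commutatorOf (e a) (e b))).toAdd : ℚ) := fun s a b => by
    simp only [B, Matrix.toBilin'_single, Matrix.of_apply]
  have hB : ∀ s i j, ∑ r, c₀ s r * ((entry (Φ r) i j : ℤ) : ℚ) = B s (v i) (v j) := by
    intro s i j
    rw [← hc₀, MonoidHom.comp_apply, hf', hom_commutatorOf_eq_sum hH.class_eq_two hH.torsionFree
      hq hker he (κ s)]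
    simp only [B, Matrix.toBilin'_apply, Matrix.of_apply]
    push_cast
    refine Finset.sum_congr rfl fun a _ => Finset.sum_congr rfl fun b _ => ?_
    simp only [smul_eq_mul, Int.cast_mul]
    change (u i a : ℚ) * u j b * _ = u i a * _ * u j b
    ring
  have hskew : ∀ s x y, B s x y = -B s y x := by
    intro s x y
    simp only [B, Matrix.toBilin'_apply, Matrix.of_apply]
    rw [Finset.sum_comm, ← Finset.sum_neg_distrib]
    refine Finset.sum_congr rfl fun a _ => ?_
    rw [← Finset.sum_neg_distrib]
    refine Finset.sum_congr rfl fun b _ => ?_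
    rw [← commutatorOf_inv (e a), map_inv, toAdd_inv]
    push_cast
    ring
  -- The combinations `c₀ s` are independent: a relation `d` among them makes `∑ d s • B s` vanish
  -- on the spanning `v i`, hence everywhere, so the functional `d` composed with `p` is zero on
  -- `H'`; as `p` is onto, `d = 0`.
  have hw : Submodule.span ℚ (Set.range fun (r : Fin t) (s : Fin t₀) => c₀ s r) = ⊤ := by
    refine span_eq_top_of_dual _ fun d hd => ?_
    have hv0 : ∀ i j, ∑ s, d s * B s (v i) (v j) = 0 := by
      intro i j
      simp only [← hB, Finset.mul_sum]
      rw [Finset.sum_comm]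
      refine Finset.sum_eq_zero fun r _ => ?_
      rw [← zero_mul ((entry (Φ r) i j : ℤ) : ℚ), ← hd r, Finset.sum_mul]
      exact Finset.sum_congr rfl fun s _ => by ring
    have hB0 : ∀ x y, ∑ s, d s * B s x y = 0 := by
      intro x y
      obtain ⟨X, hX⟩ : ∃ X : Fin n₀ → ℚ, x = ∑ a, X a • v (I a) := ⟨_, hexp x⟩
      obtain ⟨Y, hY⟩ : ∃ Y : Fin n₀ → ℚ, y = ∑ a, Y a • v (I a) := ⟨_, hexp y⟩
      have h1 : ∀ s, B s x y = ∑ a, ∑ b, X a * Y b * B s (v (I a)) (v (I b)) := fun s =>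
        -- The expansion lemma takes a single family of vectors, so `x` and `y` are packed as a
        -- family indexed by `Bool`.
        bilin_sum_sum (B s) (fun k => cond k x y) (fun k => cond k X Y) (fun a => v (I a))
          (by rintro (_ | _); exacts [hY, hX]) true false
      simp only [h1, Finset.mul_sum]
      rw [Finset.sum_comm]
      refine Finset.sum_eq_zero fun a _ => ?_
      rw [Finset.sum_comm]
      refine Finset.sum_eq_zero fun b _ => ?_
      have h2 := hv0 (I a) (I b)
      rw [← mul_zero (X a * Y b), ← h2, Finset.mul_sum]
      exact Finset.sum_congr rfl fun s _ => by ring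
    let ev : (Fin t₀ → ℤ) →+ ℚ :=
      { toFun := fun y => ∑ s, d s * y s
        map_zero' := by simp
        map_add' := fun y z => by simp [mul_add, Finset.sum_add_distrib] }
    let δ : commutator H →* Multiplicative ℚ := (AddMonoidHom.toMultiplicative ev).comp p
    have hδe : ∀ a b, (δ (commutatorOf (e a) (e b))).toAdd = 0 := by
      intro a b
      rw [← hB0 (Pi.single a 1) (Pi.single b 1)]
      simp only [hBe]
      rfl
    have hδ : δ = 1 := by
      refine MonoidHom.eq_of_eqOn_dense closure_commutatorOf ?_
      rintro _ ⟨⟨x, y⟩, rfl⟩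
      have h1 := hom_commutatorOf_eq_sum hH.class_eq_two hH.torsionFree hq hker he δ x y
      simp only [hδe, smul_zero, Finset.sum_const_zero] at h1
      exact h1
    funext s
    obtain ⟨z, hz⟩ := hp.2 (Multiplicative.ofAdd (Pi.single s 1))
    have h1 : ev (p z).toAdd = 0 := DFunLike.congr_fun hδ z
    rw [hz] at h1
    have h2 : ∑ s', d s' * ((Pi.single s 1 : Fin t₀ → ℤ) s' : ℚ) = 0 := h1
    rw [Finset.sum_eq_single s] at h2
    · simpa using h2
    · intro s' _ hs; simp [Pi.single_eq_of_ne hs]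
    · simp
  obtain ⟨J, E, hE, -⟩ := exists_embedding_dual _ hw
  -- Passing to the bases `v (I a)` of `ℚ^n₀` and `c₀ · (J s)` of `ℚ^t₀` by means of the dual bases
  -- `D` and `E` gives the identity blocks required of a chart.
  refine ⟨I, J, fun i a => ∑ s, D a s * v i s, fun a r => ∑ s, E a s * c₀ s r,
    fun a b b' => ∑ s, E a s * B s (v (I b)) (v (I b')), ?_, ?_, ?_, ?_⟩
  · exact fun a b => hD a b
  · exact fun s s' => (hE s' s).trans (if_congr eq_comm rfl rfl)
  · intro s a b
    rw [← Finset.sum_neg_distrib]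
    exact Finset.sum_congr rfl fun s' _ => by rw [hskew, mul_neg]
  · intro a i j
    have h1 : ∑ r, (∑ s, E a s * c₀ s r) * ((entry (Φ r) i j : ℤ) : ℚ) =
        ∑ s, E a s * B s (v i) (v j) := by
      simp only [← hB, Finset.mul_sum, Finset.sum_mul]
      rw [Finset.sum_comm]
      exact Finset.sum_congr rfl fun s _ => Finset.sum_congr rfl fun r _ => by ring
    rw [h1]
    have h2 : ∀ s, B s (v i) (v j) = _ := fun s =>
      bilin_sum_sum (B s) v (fun i a => ∑ s, D a s * v i s) (fun a => v (I a))
        (fun i => hexp (v i)) i j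
    simp only [h2, Finset.mul_sum]
    rw [Finset.sum_comm]
    refine Finset.sum_congr rfl fun b _ => ?_
    rw [Finset.sum_comm]
    refine Finset.sum_congr rfl fun b' _ => Finset.sum_congr rfl fun s _ => by ring

open MvPolynomial in
theorem isGeneric_not_surjectsOntoN₂ (ht₀ : 0 < t₀)
    (h : (t : ℚ) < (n : ℚ) * (n - 1) / 2 - (n : ℚ) * n₀ / t₀ + (n₀ : ℚ) ^ 2 / t₀ + t₀
          - (n₀ : ℚ) * (n₀ - 1) / 2) :
    IsGeneric n t (fun G _ => ¬ SurjectsOntoN₂ n₀ t₀ G) := by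
  choose P hP0 hP using fun (I : Fin n₀ ↪ Fin n) (J : Fin t₀ ↪ Fin t) =>
    exists_polynomial_vanishing_on_chart I J ht₀ h
  -- One hypersurface covers all charts. If there are no embeddings the product is `1` and its zero
  -- set is empty.
  let Q : MvPolynomial (Fin t × Pairs n) ℚ := ∏ I, ∏ J, P I J
  have hQ : Q ≠ 0 :=
    Finset.prod_ne_zero_iff.2 fun I _ => Finset.prod_ne_zero_iff.2 fun J _ => hP0 I J
  let g : Fin t × Pairs n → Fin t × Fin n × Fin n := fun z => (z.1, z.2.1, z.2.lower)
  refine ⟨{Ψ | ∀ p ∈ ({rename g Q} : Set (MvPolynomial (Fin t × Fin n × Fin n) ℚ)),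
    eval (fun c => entry (Ψ c.1) c.2.1 c.2.2) p = 0}, ⟨_, rfl⟩, ?_, ?_⟩
  · intro huniv
    refine hQ (MvPolynomial.funext fun x => ?_)
    -- Entries below the diagonal can be prescribed freely for alternating forms, so a polynomial in
    -- them that vanishes at all tuples is zero.
    let M : Fin t → Fin n → Fin n → ℚ := fun r i j =>
      if hij : j < i then x (r, ⟨i, ⟨j, hij⟩⟩) else
        if hij : i < j then -x (r, ⟨j, ⟨i, hij⟩⟩) else 0
    have hM : ∀ r i j, M r i j = -M r j i := by
      intro r i j
      rcases lt_trichotomy i j with hij | rfl | hij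
      · simp [M, hij, hij.asymm]
      · simp [M]
      · simp [M, hij, hij.asymm]
    choose Ψ hΨ using fun r => exists_altForm_of_skew (M r) (hM r)
    have h1 : Ψ ∈ (Set.univ : Set (Fin t → AltForms ℚ n)) := Set.mem_univ _
    rw [← huniv] at h1
    have h2 := h1 _ rfl
    rw [eval_rename] at h2
    rw [map_zero, ← h2]
    congr 2
    funext z
    have hz : z.2.lower < z.2.1 := z.2.2.2
    simp only [Function.comp_apply, g, hΨ, M, dif_pos hz]
    rfl
  · intro Φ hΦ hsurj p hp
    obtain ⟨H, _, hH, f, hf⟩ := not_not.1 hsurj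
    obtain ⟨I, J, X, c, ψ, hchart⟩ := exists_isChart hΦ hH f hf
    rw [Set.mem_singleton_iff.1 hp, eval_rename, map_prod]
    refine Finset.prod_eq_zero (Finset.mem_univ I) ?_
    rw [map_prod]
    refine Finset.prod_eq_zero (Finset.mem_univ J) ?_
    rw [← hP I J _ _ _ _ hchart]
    congr 2
    funext z
    exact entry_toRat _ _ _

theorem add_sum_Ico_le (hn : n₀ ≤ n)
    (h : (t : ℚ) ≥ (n : ℚ) * (n - 1) / 2 - (n₀ : ℚ) * (n₀ - 1) / 2 + t₀) :
    t₀ + ∑ j ∈ Finset.Ico n₀ n, j ≤ t := by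
  have h1 : ∀ m : ℕ, ((∑ j ∈ Finset.range m, j : ℕ) : ℚ) = m * (m - 1) / 2 := by
    intro m
    induction m with
    | zero => simp
    | succ m ih => rw [Finset.sum_range_succ, Nat.cast_add, ih]; push_cast; ring
  have h2 := Finset.sum_range_add_sum_Ico (fun j => j) hn
  have h3 := congrArg (Nat.cast : ℕ → ℚ) h2
  rw [Nat.cast_add, h1, h1] at h3
  have h4 : ((t₀ + ∑ j ∈ Finset.Ico n₀ n, j : ℕ) : ℚ) ≤ t := by
    rw [Nat.cast_add]
    linarith
  exact_mod_cast h4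

end Charts

end TwoStepNilpotent

end

theorem mainTheorem6 (n n₀ t t₀ : ℕ) (hn : 0 < n) (hn₀ : 0 < n₀) (ht : 0 < t) (ht₀ : 0 < t₀) :
    ((t : ℚ) < (n : ℚ) * (n - 1) / 2 - (n : ℚ) * n₀ / t₀ + (n₀ : ℚ) ^ 2 / t₀ + t₀
          - (n₀ : ℚ) * (n₀ - 1) / 2 →
        TwoStepNilpotent.IsGeneric n t
          (fun G _ => ¬ TwoStepNilpotent.SurjectsOntoN₂ n₀ t₀ G)) ∧
      (n₀ ≤ n →
        (t : ℚ) ≥ (n : ℚ) * (n - 1) / 2 - (n₀ : ℚ) * (n₀ - 1) / 2 + t₀ →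
        ∀ (G : Type*) [Group G], TwoStepNilpotent.MemN₂ n t G →
          TwoStepNilpotent.SurjectsOntoN₂ n₀ t₀ G) := by
  exact ⟨fun h => TwoStepNilpotent.isGeneric_not_surjectsOntoN₂ ht₀ h,
    fun hle h G _ hG => hG.surjectsOntoN₂ hle ht₀ (TwoStepNilpotent.add_sum_Ico_le hle h)⟩
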